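/- Let $p(0)=1$, and for every $i\ge 1$ let $p(i),q(i)>0$ with $p(i)+q(i)=1$. Let $\{X_n\}_{n\ge 0}$ be the $(1,1)$-reflecting random walk (birth–death chain), that is, the Markov chain on $\{0,1,2,\ldots\}$ with transition probabilities $P_{01}=p(0)=1$ and, for $i\ge 1$, $P_{i,i+1}=p(i)$, $P_{i,i-1}=q(i)$, all other entries being zero. Put $$\mu_0=1,\qquad \mu_i=\frac{p(0)p(1)\cdots p(i-1)}{q(1)q(2)\cdots q(i)}\quad (i\ge 1).$$ Then the chain is recurrent (that is, for every state $i$, the chain started at $i$ almost surely returns to $i$) if and only if $$\sum_{i=0}^{\infty}\frac{1}{\mu_i\,p(i)}=\infty .$$ -/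

import Mathlib

open MeasureTheory ProbabilityTheory

noncomputable section

/-- The parameters of a (1,1) reflecting random walk (birth–death chain) on `{0, 1, 2, …}`:
upward probabilities `p i` and downward probabilities `q i`, with reflection at `0`.
The number `q 0` plays no role. -/
structure ReflectingWalk where
  p : ℕ → ℝ
  q : ℕ → ℝ
  p_zero : p 0 = 1
  p_pos : ∀ i, 0 < i → 0 < p i
  q_pos : ∀ i, 0 < i → 0 < q i
  q_add_p : ∀ i, 0 < i → q i + p i = 1

namespace ReflectingWalk

variable (W : ReflectingWalk)

/-- The transition probabilities `P i j`: from `0` the walk moves to `1` with probability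
`p 0 = 1`; from `i ≥ 1` it moves to `i + 1` with probability `p i` and to `i - 1` with
probability `q i`. -/
def P (i j : ℕ) : ℝ :=
  if j = i + 1 then W.p i else if i = j + 1 then W.q i else 0

theorem P_nonneg (i j : ℕ) : 0 ≤ W.P i j := by
  unfold P
  split_ifs with h1 h2
  · rcases Nat.eq_zero_or_pos i with rfl | hi
    · rw [W.p_zero]; exact zero_le_one
    · exact (W.p_pos i hi).le
  · exact (W.q_pos i (by omega)).le
  · exact le_rfl

theorem hasSum_P (i : ℕ) : HasSum (W.P i) 1 := by
  rcases Nat.eq_zero_or_pos i with rfl | hi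
  · have h : W.P 0 1 = 1 := by simp [P, W.p_zero]
    rw [← h]
    refine hasSum_single 1 fun j hj => ?_
    simp [P, hj]
  · have h : ∑ j ∈ ({i + 1, i - 1} : Finset ℕ), W.P i j = 1 := by
      rw [Finset.sum_pair (by omega), ← W.q_add_p i hi, add_comm]
      have h1 : i - 1 ≠ i + 1 := by omega
      have h2 : i = i - 1 + 1 := by omega
      simp only [P, if_true, if_neg h1, if_pos h2]
    rw [← h]
    refine hasSum_sum_of_ne_finset_zero fun j hj => ?_
    simp only [Finset.mem_insert, Finset.mem_singleton, not_or] at hj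
    have h1 : i ≠ j + 1 := by omega
    simp only [P, if_neg hj.1, if_neg h1]

/-- The row `P i ·` of the transition matrix as a probability distribution on `ℕ`. -/
def step (i : ℕ) : PMF ℕ :=
  ⟨fun j => ENNReal.ofReal (W.P i j), by
    have h := W.hasSum_P i
    have h' := ENNReal.ofReal_tsum_of_nonneg (W.P_nonneg i) h.summable
    rw [h.tsum_eq, ENNReal.ofReal_one] at h'
    rw [h']
    exact ENNReal.summable.hasSum⟩

/-- `μ 0 = 1` and `μ i = p 0 ⋯ p (i-1) / (q 1 ⋯ q i)`. -/
def mu (i : ℕ) : ℝ :=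
  (∏ k ∈ Finset.range i, W.p k) / ∏ k ∈ Finset.range i, W.q (k + 1)

end ReflectingWalk

/-- The Markov kernel on `ℕ` with transition probabilities `S i j`. -/
def stepKernel (S : ℕ → PMF ℕ) : Kernel ℕ ℕ :=
  Kernel.ofFunOfCountable fun i => (S i).toMeasure

instance (S : ℕ → PMF ℕ) : IsMarkovKernel (stepKernel S) :=
  ⟨fun i => inferInstanceAs (IsProbabilityMeasure (S i).toMeasure)⟩

/-- The law of the next position given the positions up to time `n`: it depends only on the
position at time `n`, through the transition probabilities `S`. -/
def historyKernel (S : ℕ → PMF ℕ) (n : ℕ) : Kernel (∀ _ : Finset.Iic n, ℕ) ℕ :=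
  (stepKernel S).comap (fun h => h ⟨n, Finset.mem_Iic.2 le_rfl⟩) (measurable_pi_apply _)

instance (S : ℕ → PMF ℕ) (n : ℕ) : IsMarkovKernel (historyKernel S n) := by
  unfold historyKernel; infer_instance

/-- `pathLaw S i` is the law, on the space of trajectories `ℕ → ℕ`, of the time-homogeneous
Markov chain with transition probabilities `S` started at `X 0 = i`. -/
def pathLaw (S : ℕ → PMF ℕ) (i : ℕ) : Measure (ℕ → ℕ) :=
  Kernel.traj (X := fun _ => ℕ) (historyKernel S) 0 fun _ => i

/-- The chain with transition probabilities `S` is recurrent: started from any state `i`, it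
almost surely returns to `i`, i.e. `inf {n > 0 : X n = i} < ∞` almost surely. -/
def IsRecurrentChain (S : ℕ → PMF ℕ) : Prop :=
  ∀ i : ℕ, ∀ᵐ ω ∂(pathLaw S i), ∃ n : ℕ, 0 < n ∧ ω n = i

end

open Filter Topology
open scoped ENNReal

/-! Kill the chain when it returns to `i`: the total mass of `tabooLaw S i n` decreases to the
probability of never returning. The scale function `scaleAbove i`, with increments `1 / (μ k * p k)`
above `i` and zero below, is harmonic off `i`, so its integral against the killed law is a constant
`c > 0` from time 1 on (`lintegral_tabooLaw_scaleAbove`). If the series converges, the scale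
function is bounded by its sum, so for `i = 0` the surviving mass stays bounded below. If it
diverges, the mass at each fixed state tends to 0 (`tendsto_tabooLaw_singleton`), so surviving mass
drifts above every level `N`. Markov's inequality gives `scaleAbove i N * P(no return) ≤ c`, and `N
→ ∞` forces the probability to be 0. -/

/-- The trajectories that do not visit `i` at any of the times `1, …, n`. -/
def noReturn (i n : ℕ) : Set (ℕ → ℕ) := {ω | ∀ m, 0 < m → m ≤ n → ω m ≠ i}

theorem measurableSet_noReturn (i n : ℕ) : MeasurableSet (noReturn i n) := by
  simp only [noReturn, Set.ofPred_forall]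
  exact .iInter fun m => .iInter fun _ => .iInter fun _ =>
    (MeasurableSet.of_discrete (s := ({i}ᶜ : Set ℕ))).preimage (measurable_pi_apply m)

theorem noReturn_succ (i n : ℕ) :
    noReturn i (n + 1) = noReturn i n ∩ {ω | ω (n + 1) ≠ i} := by
  ext ω
  refine ⟨fun h => ⟨fun m hm hmn => h m hm (by omega), h _ n.succ_pos le_rfl⟩, ?_⟩
  rintro ⟨h, h'⟩ m hm hmn
  rcases Nat.lt_or_eq_of_le hmn with hlt | rfl
  · exact h m hm (by omega)
  · exact h'

instance (S : ℕ → PMF ℕ) (i : ℕ) : IsProbabilityMeasure (pathLaw S i) := by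
  unfold pathLaw; infer_instance

theorem pathLaw_map_zero (S : ℕ → PMF ℕ) (i : ℕ) :
    (pathLaw S i).map (fun ω => ω 0) = Measure.dirac i := by
  have hf : (fun ω : ℕ → ℕ => ω 0) =
      (fun h : ∀ _ : Finset.Iic 0, ℕ => h ⟨0, Finset.mem_Iic.2 le_rfl⟩) ∘
        Preorder.frestrictLe (π := fun _ => ℕ) 0 := rfl
  have hg : Measurable fun h : ∀ _ : Finset.Iic 0, ℕ => h ⟨0, Finset.mem_Iic.2 le_rfl⟩ :=
    measurable_pi_apply _
  rw [hf, ← Measure.map_map hg (by fun_prop), pathLaw, Kernel.traj_map_frestrictLe_apply,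
    Kernel.partialTraj_self, Kernel.id_apply, Measure.map_dirac' hg]

/-- One-step conditioning: given the history up to time `n`, the position at time `n + 1` is
distributed according to the transition probabilities from the position at time `n`. -/
theorem lintegral_pathLaw_succ (S : ℕ → PMF ℕ) (i n : ℕ)
    {f : (∀ _ : Finset.Iic n, ℕ) × ℕ → ℝ≥0∞} (hf : Measurable f) :
    ∫⁻ ω, f (Preorder.frestrictLe (π := fun _ => ℕ) n ω, ω (n + 1)) ∂pathLaw S i =
      ∫⁻ ω, ∫⁻ y, f (Preorder.frestrictLe (π := fun _ => ℕ) n ω, y) ∂(S (ω n)).toMeasure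
        ∂pathLaw S i := by
  have hpair : Measurable fun ω : ℕ → ℕ =>
      (Preorder.frestrictLe (π := fun _ => ℕ) n ω, ω (n + 1)) := by fun_prop
  rw [← lintegral_map hf hpair, pathLaw,
    ← Kernel.partialTraj_compProd_eq_map_traj (X := fun _ => ℕ) (κ := historyKernel S)
      (zero_le (a := n)), Measure.lintegral_compProd hf,
    ← Kernel.traj_map_frestrictLe_apply,
    lintegral_map (hf.lintegral_kernel_prod_right') (by fun_prop)]
  rfl

/-- The law of the position at time `n` of the chain started at `i`, on the event that it has
not returned to `i` up to time `n`. -/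
noncomputable def tabooLaw (S : ℕ → PMF ℕ) (i n : ℕ) : Measure ℕ :=
  ((pathLaw S i).restrict (noReturn i n)).map fun ω => ω n

/-! ### Mass balance and decay of the killed law, for a general chain. -/

section Taboo

variable (S : ℕ → PMF ℕ) (i : ℕ)

theorem tabooLaw_univ (n : ℕ) : tabooLaw S i n Set.univ = pathLaw S i (noReturn i n) := by
  rw [tabooLaw, Measure.map_apply (measurable_pi_apply n) .univ]
  simp

theorem lintegral_tabooLaw (n : ℕ) (g : ℕ → ℝ≥0∞) :
    ∫⁻ k, g k ∂tabooLaw S i n =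
      ∫⁻ ω, (noReturn i n).indicator (fun ω => g (ω n)) ω ∂pathLaw S i := by
  rw [tabooLaw, lintegral_map .of_discrete (measurable_pi_apply n),
    lintegral_indicator (measurableSet_noReturn i n)]

theorem tabooLaw_zero : tabooLaw S i 0 = Measure.dirac i := by
  have h : noReturn i 0 = Set.univ :=
    Set.eq_univ_of_forall fun ω m hm hm' => absurd hm (by omega)
  rw [tabooLaw, h, Measure.restrict_univ, pathLaw_map_zero]

theorem lintegral_tabooLaw_succ (n : ℕ) (g : ℕ → ℝ≥0∞) :
    ∫⁻ k, g k ∂tabooLaw S i (n + 1) =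
      ∫⁻ k, ∫⁻ j, ({i}ᶜ : Set ℕ).indicator g j ∂(S k).toMeasure ∂tabooLaw S i n := by
  let H : Set (∀ _ : Finset.Iic n, ℕ) := {h | ∀ m : Finset.Iic n, 0 < m.1 → h m ≠ i}
  have hH : MeasurableSet H := by
    simp only [H, Set.ofPred_forall]
    exact .iInter fun m => .iInter fun _ =>
      (MeasurableSet.of_discrete (s := ({i}ᶜ : Set ℕ))).preimage (measurable_pi_apply m)
  have hmem (ω : ℕ → ℕ) : Preorder.frestrictLe (π := fun _ => ℕ) n ω ∈ H ↔ ω ∈ noReturn i n :=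
    ⟨fun h m hm hmn => h ⟨m, Finset.mem_Iic.2 hmn⟩ hm,
      fun h m hm => h m.1 hm (Finset.mem_Iic.1 m.2)⟩
  have hf : Measurable fun x : (∀ _ : Finset.Iic n, ℕ) × ℕ =>
      H.indicator (fun _ => (1 : ℝ≥0∞)) x.1 * ({i}ᶜ : Set ℕ).indicator g x.2 :=
    ((measurable_const.indicator hH).comp measurable_fst).mul
      ((Measurable.of_discrete (f := ({i}ᶜ : Set ℕ).indicator g)).comp measurable_snd)
  rw [lintegral_tabooLaw, lintegral_tabooLaw]
  convert lintegral_pathLaw_succ S i n hf using 2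
  · ext ω
    classical
    simp only [noReturn_succ, Set.indicator_apply, hmem, Set.mem_inter_iff, Set.mem_ofPred_eq,
      Set.mem_compl_iff, Set.mem_singleton_iff]
    by_cases h1 : ω ∈ noReturn i n <;> by_cases h2 : ω (n + 1) = i <;> simp [h1, h2]
  · ext ω
    dsimp only
    rw [lintegral_const_mul _ .of_discrete]
    by_cases h1 : ω ∈ noReturn i n <;> simp [h1, hmem]

theorem tabooLaw_succ_self (n : ℕ) : tabooLaw S i (n + 1) {i} = 0 := by
  have h : ({i}ᶜ : Set ℕ).indicator (({i} : Set ℕ).indicator 1) = (0 : ℕ → ℝ≥0∞) := by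
    rw [Set.indicator_indicator, Set.compl_inter_self, Set.indicator_empty]; rfl
  rw [← lintegral_indicator_one (.singleton i), lintegral_tabooLaw_succ, h]
  simp

/-- The mass lost in one step is exactly the mass that jumps onto `i`. -/
theorem tabooLaw_univ_eq_add (n : ℕ) :
    tabooLaw S i n Set.univ =
      tabooLaw S i (n + 1) Set.univ + ∫⁻ k, S k i ∂tabooLaw S i n := by
  rw [← lintegral_one, ← lintegral_one, lintegral_tabooLaw_succ,
    ← lintegral_add_left .of_discrete]
  refine lintegral_congr fun k => ?_
  have h : ({i}ᶜ : Set ℕ).indicator (fun _ => (1 : ℝ≥0∞)) = ({i}ᶜ : Set ℕ).indicator 1 := rfl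
  rw [h, lintegral_indicator_one .of_discrete, ← PMF.toMeasure_apply_singleton _ _ (.singleton i),
    add_comm, measure_add_measure_compl (.singleton i), measure_univ]

/-- The losses telescope: their sum is at most the initial mass 1, so they tend to 0. -/
theorem tendsto_lintegral_tabooLaw_step :
    Tendsto (fun n => ∫⁻ k, S k i ∂tabooLaw S i n) atTop (𝓝 0) := by
  have hsum (N : ℕ) : ∑ n ∈ Finset.range N, ∫⁻ k, S k i ∂tabooLaw S i n +
      tabooLaw S i N Set.univ = 1 := by
    induction N with
    | zero => simp [tabooLaw_zero]
    | succ N ih => rw [← ih, tabooLaw_univ_eq_add S i N, Finset.sum_range_succ]; ring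
  refine ENNReal.tendsto_atTop_zero_of_tsum_ne_top
    (ne_top_of_le_ne_top ENNReal.one_ne_top ?_)
  rw [ENNReal.tsum_eq_iSup_nat]
  exact iSup_le fun N => le_self_add.trans (hsum N).le

variable {S i}

/-- If `k` leads in one step to `i`, or to a state whose taboo probability tends to `0`, then
the taboo probability of `k` tends to `0`. -/
theorem tendsto_tabooLaw_singleton_of_step {j k : ℕ}
    (hj : j = i ∨ Tendsto (fun n => tabooLaw S i n {j}) atTop (𝓝 0)) (hk : S k j ≠ 0) :
    Tendsto (fun n => tabooLaw S i n {k}) atTop (𝓝 0) := by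
  -- `u n` is the mass entering `j` at time `n + 1`: the loss if `j = i`, the killed mass at `j`
  -- otherwise.
  suffices h : ∃ u : ℕ → ℝ≥0∞, Tendsto u atTop (𝓝 0) ∧ ∀ n, S k j * tabooLaw S i n {k} ≤ u n by
    obtain ⟨u, hu, hle⟩ := h
    have hu' : Tendsto (fun n => u n / S k j) atTop (𝓝 0) := by
      simpa using ENNReal.Tendsto.div_const hu (Or.inr hk)
    refine tendsto_of_tendsto_of_tendsto_of_le_of_le tendsto_const_nhds hu' (fun _ => zero_le)
      fun n => ?_
    rw [ENNReal.le_div_iff_mul_le (Or.inl hk) (Or.inl (PMF.apply_ne_top _ _)), mul_comm]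
    exact hle n
  have hmarkov (n : ℕ) (f : ℕ → ℝ≥0∞) :
      f k * tabooLaw S i n {k} ≤ ∫⁻ x, f x ∂tabooLaw S i n := by
    rw [← lintegral_singleton f k]
    exact setLIntegral_le_lintegral _ _
  by_cases hji : j = i
  · subst hji
    exact ⟨_, tendsto_lintegral_tabooLaw_step S j, fun n => hmarkov n fun x => S x j⟩
  · refine ⟨_, (tendsto_add_atTop_iff_nat 1).2 (hj.resolve_left hji), fun n => ?_⟩
    have h : ({i}ᶜ : Set ℕ).indicator (({j} : Set ℕ).indicator 1) =
        (({j} : Set ℕ).indicator 1 : ℕ → ℝ≥0∞) := by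
      rw [Set.indicator_indicator, Set.inter_eq_right.2 (by simpa using Ne.symm hji)]
    rw [← lintegral_indicator_one (.singleton j), lintegral_tabooLaw_succ, h]
    simp only [lintegral_indicator_one (MeasurableSet.singleton j),
      PMF.toMeasure_apply_singleton _ _ (MeasurableSet.singleton j)]
    exact hmarkov n fun x => S x j

variable (S i)

theorem tendsto_tabooLaw_univ :
    Tendsto (fun n => tabooLaw S i n Set.univ) atTop (𝓝 (pathLaw S i (⋂ n, noReturn i n))) := by
  simp only [tabooLaw_univ]
  refine tendsto_measure_iInter_atTop
    (fun n => (measurableSet_noReturn i n).nullMeasurableSet) ?_ ⟨0, measure_ne_top _ _⟩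
  exact fun a b hab ω h m hm hma => h m hm (hma.trans hab)

theorem isRecurrentChain_iff :
    IsRecurrentChain S ↔ ∀ i, pathLaw S i (⋂ n, noReturn i n) = 0 := by
  refine forall_congr' fun i => ?_
  rw [ae_iff]
  have h : {ω : ℕ → ℕ | ¬∃ n, 0 < n ∧ ω n = i} = ⋂ n, noReturn i n := by
    ext ω
    simp only [Set.mem_ofPred_eq, not_exists, not_and, Set.mem_iInter]
    exact ⟨fun h n m hm _ => h m hm, fun h m hm => h m m hm le_rfl⟩
  rw [h]

end Taboo

/-! ### The scale function of the birth–death chain. -/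

namespace ReflectingWalk

variable (W : ReflectingWalk)

theorem p_pos' (k : ℕ) : 0 < W.p k := by
  rcases Nat.eq_zero_or_pos k with rfl | hk
  · rw [W.p_zero]; exact one_pos
  · exact W.p_pos k hk

theorem mu_pos (k : ℕ) : 0 < W.mu k :=
  div_pos (Finset.prod_pos fun j _ => W.p_pos' j)
    (Finset.prod_pos fun j _ => W.q_pos (j + 1) j.succ_pos)

theorem mu_succ (k : ℕ) : W.mu (k + 1) * W.q (k + 1) = W.mu k * W.p k := by
  have hq := (W.q_pos (k + 1) k.succ_pos).ne'
  have hprod : ∏ j ∈ Finset.range k, W.q (j + 1) ≠ 0 :=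
    (Finset.prod_pos fun j _ => W.q_pos (j + 1) j.succ_pos).ne'
  simp only [mu, Finset.prod_range_succ]
  field_simp

theorem step_apply (k j : ℕ) : W.step k j = ENNReal.ofReal (W.P k j) := rfl

theorem step_succ_right (k : ℕ) : W.step k (k + 1) = ENNReal.ofReal (W.p k) := by
  simp [step_apply, P]

theorem step_succ_left (k : ℕ) : W.step (k + 1) k = ENNReal.ofReal (W.q (k + 1)) := by
  rw [step_apply, P, if_neg (by omega), if_pos rfl]

theorem lintegral_step_zero (g : ℕ → ℝ≥0∞) : ∫⁻ j, g j ∂(W.step 0).toMeasure = g 1 := by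
  rw [lintegral_countable', tsum_eq_single 1]
  · rw [PMF.toMeasure_apply_singleton _ _ (.singleton _), step_succ_right, W.p_zero]
    simp
  · intro j hj
    rw [PMF.toMeasure_apply_singleton _ _ (.singleton _), step_apply]
    simp [P, hj]

theorem lintegral_step_succ (k : ℕ) (g : ℕ → ℝ≥0∞) :
    ∫⁻ j, g j ∂(W.step (k + 1)).toMeasure =
      ENNReal.ofReal (W.p (k + 1)) * g (k + 2) + ENNReal.ofReal (W.q (k + 1)) * g k := by
  rw [lintegral_countable', tsum_eq_sum (s := {k + 2, k})]
  · rw [Finset.sum_pair (by omega)]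
    simp only [PMF.toMeasure_apply_singleton _ _ (MeasurableSet.singleton _)]
    rw [step_succ_right, step_succ_left, mul_comm, mul_comm (g k)]
  · intro j hj
    simp only [Finset.mem_insert, Finset.mem_singleton, not_or] at hj
    rw [PMF.toMeasure_apply_singleton _ _ (.singleton _), step_apply, P, if_neg hj.1,
      if_neg (by omega)]
    simp

/-- The increment `1 / (μ k * p k)` of the scale function between `k` and `k + 1`. -/
noncomputable def scaleStep (k : ℕ) : ℝ≥0∞ := ENNReal.ofReal (1 / (W.mu k * W.p k))

/-- By detailed balance (`mu_succ`), both sides equal `1 / μ (k + 1)`. This is harmonicity of the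
scale function in terms of its increments. -/
theorem scaleStep_balance (k : ℕ) :
    ENNReal.ofReal (W.p (k + 1)) * W.scaleStep (k + 1) =
      ENNReal.ofReal (W.q (k + 1)) * W.scaleStep k := by
  rw [scaleStep, scaleStep, ← ENNReal.ofReal_mul (W.p_pos' _).le,
    ← ENNReal.ofReal_mul (W.q_pos _ k.succ_pos).le, ← W.mu_succ k]
  have h1 := (W.p_pos' (k + 1)).ne'
  have h2 := (W.q_pos (k + 1) k.succ_pos).ne'
  have h3 := (W.mu_pos (k + 1)).ne'
  congr 1
  field_simp

/-- The scale function of the walk above the level `i`; it vanishes below `i`. -/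
noncomputable def scaleAbove (i j : ℕ) : ℝ≥0∞ := ∑ k ∈ Finset.Ico i j, W.scaleStep k

theorem scaleAbove_of_le {i j : ℕ} (h : j ≤ i) : W.scaleAbove i j = 0 := by
  rw [scaleAbove, Finset.Ico_eq_empty_of_le h, Finset.sum_empty]

theorem scaleAbove_succ {i j : ℕ} (h : i ≤ j) :
    W.scaleAbove i (j + 1) = W.scaleAbove i j + W.scaleStep j :=
  Finset.sum_Ico_succ_top h _

theorem scaleAbove_mono (i : ℕ) : Monotone (W.scaleAbove i) := fun _ _ h =>
  Finset.sum_le_sum_of_subset (Finset.Ico_subset_Ico_right h)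

theorem lintegral_step_scaleAbove {i j : ℕ} (h : j ≠ i) :
    ∫⁻ x, W.scaleAbove i x ∂(W.step j).toMeasure = W.scaleAbove i j := by
  rcases Nat.lt_or_gt_of_ne h with hlt | hgt
  · rw [W.scaleAbove_of_le hlt.le]
    rcases j with _ | j
    · rw [lintegral_step_zero, W.scaleAbove_of_le (by omega)]
    · rw [lintegral_step_succ, W.scaleAbove_of_le (by omega), W.scaleAbove_of_le (by omega)]
      simp
  · obtain ⟨j, rfl⟩ := Nat.exists_eq_succ_of_ne_zero (Nat.ne_zero_of_lt hgt)
    have hsum : ENNReal.ofReal (W.p (j + 1)) + ENNReal.ofReal (W.q (j + 1)) = 1 := by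
      rw [← ENNReal.ofReal_add (W.p_pos' _).le (W.q_pos _ j.succ_pos).le, add_comm,
        W.q_add_p _ j.succ_pos, ENNReal.ofReal_one]
    rw [lintegral_step_succ, W.scaleAbove_succ (by omega : i ≤ j + 1), mul_add,
      scaleStep_balance, add_assoc, ← mul_add, add_comm (W.scaleStep j),
      ← W.scaleAbove_succ (by omega : i ≤ j), ← add_mul, hsum, one_mul]

theorem lintegral_step_scaleAbove_self (i : ℕ) :
    ∫⁻ x, W.scaleAbove i x ∂(W.step i).toMeasure = ENNReal.ofReal (W.p i) * W.scaleStep i := by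
  have h : W.scaleAbove i (i + 1) = W.scaleStep i := by
    rw [W.scaleAbove_succ le_rfl, W.scaleAbove_of_le le_rfl, zero_add]
  rcases i with _ | i
  · rw [lintegral_step_zero, h, W.p_zero, ENNReal.ofReal_one, one_mul]
  · rw [lintegral_step_succ, h, W.scaleAbove_of_le (by omega), mul_zero, add_zero]

/-- The scale function above `i` is conserved by the walk killed on returning to `i`. -/
theorem lintegral_tabooLaw_scaleAbove (i n : ℕ) :
    ∫⁻ x, W.scaleAbove i x ∂tabooLaw W.step i (n + 1) =
      ENNReal.ofReal (W.p i) * W.scaleStep i := by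
  have hind : ({i}ᶜ : Set ℕ).indicator (W.scaleAbove i) = W.scaleAbove i := by
    rw [Set.indicator_eq_self]
    rintro x hx rfl
    exact hx (W.scaleAbove_of_le le_rfl)
  induction n with
  -- At time 0 all mass sits at `i`, the one point where harmonicity fails; this first step produces
  -- the constant.
  | zero =>
    rw [lintegral_tabooLaw_succ, hind, tabooLaw_zero, lintegral_dirac,
      lintegral_step_scaleAbove_self]
  | succ n ih =>
    rw [lintegral_tabooLaw_succ, hind, ← ih]
    refine lintegral_congr_ae ?_
    have hae : ∀ᵐ x ∂tabooLaw W.step i (n + 1), x ≠ i := by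
      simpa [ae_iff] using tabooLaw_succ_self W.step i n
    filter_upwards [hae] with x hx using W.lintegral_step_scaleAbove hx

/-- Decay spreads outward from `i`: a state above `i` leads down, and a state below leads up, to one
already treated. -/
theorem tendsto_tabooLaw_singleton (i k : ℕ) :
    Tendsto (fun n => tabooLaw W.step i n {k}) atTop (𝓝 0) := by
  have hup (j : ℕ) : W.step j (j + 1) ≠ 0 := by
    simpa [step_succ_right] using W.p_pos' j
  have hdown (j : ℕ) : W.step (j + 1) j ≠ 0 := by
    simpa [step_succ_left] using W.q_pos (j + 1) j.succ_pos
  have habove (m : ℕ) : i + m = i ∨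
      Tendsto (fun n => tabooLaw W.step i n {i + m}) atTop (𝓝 0) := by
    induction m with
    | zero => exact Or.inl rfl
    | succ m ih => exact Or.inr (tendsto_tabooLaw_singleton_of_step ih (hdown (i + m)))
  have hbelow (m j : ℕ) (hm : j + m = i) : j = i ∨
      Tendsto (fun n => tabooLaw W.step i n {j}) atTop (𝓝 0) := by
    induction m generalizing j with
    | zero => exact Or.inl hm
    | succ m ih =>
      exact Or.inr (tendsto_tabooLaw_singleton_of_step (ih (j + 1) (by omega)) (hup j))
  rcases Nat.lt_trichotomy k i with h | rfl | h
  · exact (hbelow (i - k) k (by omega)).resolve_left h.ne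
  · rw [← tendsto_add_atTop_iff_nat 1]
    simp only [tabooLaw_succ_self]
    exact tendsto_const_nhds
  · obtain ⟨m, rfl⟩ := Nat.exists_eq_add_of_le h.le
    exact (habove m).resolve_left h.ne'

theorem pathLaw_iInter_noReturn_le (i N : ℕ) :
    W.scaleAbove i N * pathLaw W.step i (⋂ n, noReturn i n) ≤
      ENNReal.ofReal (W.p i) * W.scaleStep i := by
  have htop : W.scaleAbove i N ≠ ⊤ := ENNReal.sum_ne_top.2 fun _ _ => ENNReal.ofReal_ne_top
  have hlow : Tendsto (fun n => tabooLaw W.step i (n + 1) (Set.Iio N)) atTop (𝓝 0) := by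
    have h : Tendsto (fun n => ∑ k ∈ Finset.range N, tabooLaw W.step i (n + 1) {k}) atTop
        (𝓝 (∑ k ∈ Finset.range N, 0)) := tendsto_finsetSum _ fun k _ =>
      (tendsto_add_atTop_iff_nat 1).2 (W.tendsto_tabooLaw_singleton i k)
    simpa only [sum_measure_singleton, Finset.coe_range, Finset.sum_const_zero] using h
  have hbound (n : ℕ) : W.scaleAbove i N * tabooLaw W.step i (n + 1) Set.univ ≤
      W.scaleAbove i N * tabooLaw W.step i (n + 1) (Set.Iio N) +
        ENNReal.ofReal (W.p i) * W.scaleStep i := by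
    -- Markov's inequality for the conserved integral, as the scale function is at least its value
    -- at `N` on states `≥ N`.
    have hmarkov : W.scaleAbove i N * tabooLaw W.step i (n + 1) (Set.Iio N)ᶜ ≤
        ENNReal.ofReal (W.p i) * W.scaleStep i := by
      rw [← W.lintegral_tabooLaw_scaleAbove i n]
      refine (mul_le_mul_right (measure_mono fun x hx => ?_) _).trans
        (mul_meas_ge_le_lintegral (.of_discrete) (W.scaleAbove i N))
      exact W.scaleAbove_mono i (not_lt.1 hx)
    rw [← measure_add_measure_compl (MeasurableSet.of_discrete (s := Set.Iio N)), mul_add]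
    gcongr
  have hleft := ENNReal.Tendsto.const_mul (a := W.scaleAbove i N)
    ((tendsto_add_atTop_iff_nat 1).2 (tendsto_tabooLaw_univ W.step i)) (Or.inr htop)
  have hright := (ENNReal.Tendsto.const_mul (a := W.scaleAbove i N) hlow
    (Or.inr htop)).add_const (ENNReal.ofReal (W.p i) * W.scaleStep i)
  rw [mul_zero, zero_add] at hright
  exact le_of_tendsto_of_tendsto' hleft hright hbound

theorem iSup_scaleAbove_eq_top (i : ℕ) (h : ∑' k, W.scaleStep k = ⊤) :
    ⨆ N, W.scaleAbove i N = ⊤ := by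
  have hfin : ∑ k ∈ Finset.range i, W.scaleStep k ≠ ⊤ :=
    ENNReal.sum_ne_top.2 fun _ _ => ENNReal.ofReal_ne_top
  rw [ENNReal.tsum_eq_iSup_nat] at h
  by_contra hne
  refine (ENNReal.add_lt_top.2 ⟨hfin.lt_top, Ne.lt_top hne⟩).not_ge (h ▸ iSup_le fun N => ?_)
  refine le_trans ?_ (add_le_add_right (le_iSup (W.scaleAbove i) (max i N)) _)
  rw [scaleAbove, Finset.sum_range_add_sum_Ico _ (le_max_left i N)]
  exact Finset.sum_le_sum_of_subset (Finset.range_mono (le_max_right i N))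

end ReflectingWalk

theorem corollaryc3p1 (W : ReflectingWalk) :
    IsRecurrentChain W.step ↔
      ∑' i : ℕ, ENNReal.ofReal (1 / (W.mu i * W.p i)) = ⊤ := by
  change _ ↔ ∑' k, W.scaleStep k = ⊤
  rw [isRecurrentChain_iff]
  refine ⟨fun h => ?_, fun h i => ?_⟩
  · by_contra hne
    have hle (n : ℕ) : ENNReal.ofReal (W.p 0) * W.scaleStep 0 ≤
        (∑' k, W.scaleStep k) * tabooLaw W.step 0 (n + 1) Set.univ := by
      rw [← W.lintegral_tabooLaw_scaleAbove 0 n, ← lintegral_const]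
      exact lintegral_mono fun x => ENNReal.sum_le_tsum _
    have hlim := ENNReal.Tendsto.const_mul (a := ∑' k, W.scaleStep k)
      ((tendsto_add_atTop_iff_nat 1).2 (tendsto_tabooLaw_univ W.step 0)) (Or.inr hne)
    have h0 := ge_of_tendsto' hlim hle
    rw [h 0, mul_zero] at h0
    -- Here `p 0 * scaleStep 0 = 1`, so `h0` reads `1 ≤ 0`.
    simp [ReflectingWalk.scaleStep, ReflectingWalk.mu, W.p_zero] at h0
  · by_contra hne
    have hmul : (⨆ N, W.scaleAbove i N) * pathLaw W.step i (⋂ n, noReturn i n) ≤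
        ENNReal.ofReal (W.p i) * W.scaleStep i := by
      rw [ENNReal.iSup_mul]
      exact iSup_le (W.pathLaw_iInter_noReturn_le i)
    rw [W.iSup_scaleAbove_eq_top i h, ENNReal.top_mul hne] at hmul
    exact (ENNReal.mul_lt_top ENNReal.ofReal_lt_top ENNReal.ofReal_lt_top).not_ge hmul
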